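/- Let $n\ge 1$, let $\mathbb{B}_n=\{z\in\mathbb{C}^n : |z|<1\}$ be the open unit ball for the Euclidean norm, and let $H^\infty(\mathbb{B}_n)$ be the space of bounded holomorphic functions $f:\mathbb{B}_n\to\mathbb{C}$ with the supremum norm. Let $\varphi:\mathbb{B}_n\to\mathbb{B}_n$ be a holomorphic map that has no fixed point in $\mathbb{B}_n$, and let $C_\varphi$ be the composition operator on $H^\infty(\mathbb{B}_n)$ given by $C_\varphi f=f\circ\varphi$. Then $C_\varphi$ is not uniformly mean ergodic on $H^\infty(\mathbb{B}_n)$; that is, the Cesàro means $$M_j(C_\varphi)=\frac1j\sum_{i=1}^{j} C_\varphi^{\,i},\qquad j\ge 1,$$ do not converge in the operator norm to any bounded linear operator on $H^\infty(\mathbb{B}_n)$ as $j\to\infty$. -/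

import Mathlib

open Filter Topology
open scoped BoundedContinuousFunction

/-- The open unit ball of `ℂⁿ` (with its Euclidean norm), as a type. -/
abbrev UnitBall (n : ℕ) : Type :=
  Metric.ball (0 : EuclideanSpace ℂ (Fin n)) 1

/-- A map defined on the unit ball of `ℂⁿ` only, with values in a complex normed space, is
holomorphic if it is the restriction of a function that is complex differentiable on the ball.
(Only the values on the ball matter, since the ball is open.) -/
def HolomorphicOnBall {n : ℕ} {F : Type*} [NormedAddCommGroup F] [NormedSpace ℂ F]
    (f : UnitBall n → F) : Prop :=
  ∃ g : EuclideanSpace ℂ (Fin n) → F,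
    DifferentiableOn ℂ g (Metric.ball 0 1) ∧ ∀ z : UnitBall n, g z = f z

/-- A holomorphic map of the unit ball of `ℂⁿ` into itself. -/
def HolomorphicSelfMap {n : ℕ} (φ : UnitBall n → UnitBall n) : Prop :=
  HolomorphicOnBall (fun z => (φ z : EuclideanSpace ℂ (Fin n)))

theorem HolomorphicOnBall.continuous {n : ℕ} {F : Type*} [NormedAddCommGroup F]
    [NormedSpace ℂ F] {f : UnitBall n → F} (hf : HolomorphicOnBall f) : Continuous f := by
  obtain ⟨g, hg, hgf⟩ := hf
  have h := continuousOn_iff_continuous_domRestrict.1 hg.continuousOn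
  convert h using 1
  funext z
  exact (hgf z).symm

theorem HolomorphicSelfMap.continuous {n : ℕ} {φ : UnitBall n → UnitBall n}
    (hφ : HolomorphicSelfMap φ) : Continuous φ :=
  Continuous.subtype_mk (HolomorphicOnBall.continuous hφ) fun z => (φ z).2

theorem HolomorphicOnBall.comp {n : ℕ} {F : Type*} [NormedAddCommGroup F]
    [NormedSpace ℂ F] {f : UnitBall n → F} (hf : HolomorphicOnBall f)
    {φ : UnitBall n → UnitBall n} (hφ : HolomorphicSelfMap φ) :
    HolomorphicOnBall (fun z => f (φ z)) := by
  obtain ⟨g, hg, hgf⟩ := hf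
  obtain ⟨ψ, hψ, hψφ⟩ := hφ
  refine ⟨fun z => g (ψ z), hg.comp hψ ?_, fun z => ?_⟩
  · intro z hz
    rw [hψφ ⟨z, hz⟩]
    exact (φ ⟨z, hz⟩).2
  · change g (ψ z) = f (φ z)
    rw [hψφ z, hgf (φ z)]

/-- The space `H^∞(B_n)` of bounded holomorphic functions on the unit ball of `ℂⁿ`. Holomorphic
functions being continuous, it is a subspace of the bounded continuous functions on the ball;
it carries the supremum norm. -/
def Hinf (n : ℕ) : Submodule ℂ (UnitBall n →ᵇ ℂ) where
  carrier := {f | HolomorphicOnBall f}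
  zero_mem' := ⟨fun _ => 0, differentiableOn_const 0, fun _ => rfl⟩
  add_mem' := by
    rintro f₁ f₂ ⟨g₁, h₁, e₁⟩ ⟨g₂, h₂, e₂⟩
    exact ⟨fun z => g₁ z + g₂ z, h₁.add h₂, fun z => by simp [e₁ z, e₂ z]⟩
  smul_mem' := by
    rintro c f ⟨g, h, e⟩
    exact ⟨fun z => c • g z, h.const_smul c, fun z => by simp [e z]⟩

/-- The composition operator `C_φ f = f ∘ φ` on `H^∞(B_n)`, as a bounded linear operator. -/
noncomputable def compOp {n : ℕ} (φ : UnitBall n → UnitBall n) (hφ : HolomorphicSelfMap φ) :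
    Hinf n →L[ℂ] Hinf n :=
  LinearMap.mkContinuous
    { toFun := fun f =>
        ⟨(f : UnitBall n →ᵇ ℂ).compContinuous ⟨φ, hφ.continuous⟩,
          HolomorphicOnBall.comp f.2 hφ⟩
      map_add' := fun _ _ => rfl
      map_smul' := fun _ _ => rfl }
    1
    (fun f => by
      rw [one_mul]
      exact BoundedContinuousFunction.norm_compContinuous_le _ _)

theorem compOp_apply {n : ℕ} (φ : UnitBall n → UnitBall n) (hφ : HolomorphicSelfMap φ)
    (f : Hinf n) (z : UnitBall n) :
    (compOp φ hφ f : UnitBall n →ᵇ ℂ) z = (f : UnitBall n →ᵇ ℂ) (φ z) := rfl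

/-- The Cesàro mean `M_j(T) = (1/j) ∑_{i=1}^j T^i` of the iterates of an operator. -/
noncomputable def cesaroMean {X : Type*} [NormedAddCommGroup X] [NormedSpace ℂ X]
    (T : X →L[ℂ] X) (j : ℕ) : X →L[ℂ] X :=
  (j : ℂ)⁻¹ • ∑ i ∈ Finset.Icc 1 j, T ^ i

/-- `T` is uniformly mean ergodic if its Cesàro means converge, in the operator norm, to some
bounded operator. -/
def UniformlyMeanErgodic {X : Type*} [NormedAddCommGroup X] [NormedSpace ℂ X]
    (T : X →L[ℂ] X) : Prop :=
  ∃ L : X →L[ℂ] X, Tendsto (fun j : ℕ => ‖cesaroMean T j - L‖) atTop (𝓝 0)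

/-! Suppose the orbit `z i` of `0` tends to a boundary point `τ` with `⟪τ, z i⟫ → 1`. The functions
`((1 + ⟪τ, z⟫) / 2) ^ m` lie in the unit ball of `Hinf n`. For fixed `m` their Cesàro means at `0`
tend to `1`, while for a fixed length `N` the mean tends to `0` as `m → ∞`. Norm convergence would
make the first limit uniform in `m`, a contradiction.

The dynamics rest on Schwarz–Pick: holomorphic self-maps do not increase `bergmanRatio`. A
relatively compact orbit yields a fixed point (`exists_fixedPoint_of_norm_orbit_le`) by almost
minimizing a sum of ratios to orbit points, which is uniformly convex. Hence, by Całka's argument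
(`exists_norm_orbit_le`), the orbit of a map without fixed points tends to the boundary. Wolff's
horospheres (`exists_invariant_horospheres`) then force `⟪τ, z i⟫ → 1`. -/

section BallGeometry

/-! ### Möbius involutions of the ball -/

theorem one_sub_norm_sq_pos {E : Type*} [NormedAddCommGroup E] {x : E} (hx : ‖x‖ < 1) : 0 < 1 - ‖x‖ ^ 2 := by
  nlinarith [norm_nonneg x]

theorem sqrt_one_sub_ne_zero {E : Type*} [NormedAddCommGroup E] {a : E} (ha : ‖a‖ < 1) : (√(1 - ‖a‖ ^ 2) : ℂ) ≠ 0 := by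
  exact_mod_cast (Real.sqrt_pos.2 (one_sub_norm_sq_pos ha)).ne'

variable {E : Type*} [NormedAddCommGroup E] [InnerProductSpace ℂ E]

theorem norm_inner_lt_one {x y : E} (hx : ‖x‖ < 1) (hy : ‖y‖ ≤ 1) : ‖inner ℂ y x‖ < 1 :=
  calc ‖inner ℂ y x‖ ≤ ‖y‖ * ‖x‖ := norm_inner_le_norm _ _
    _ ≤ 1 * ‖x‖ := by gcongr
    _ < 1 := by rwa [one_mul]

theorem one_sub_inner_ne_zero {x y : E} (hx : ‖x‖ < 1) (hy : ‖y‖ ≤ 1) :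
    1 - inner ℂ y x ≠ 0 := by
  intro h
  have h1 := norm_inner_lt_one hx hy
  rw [← sub_eq_zero.1 h, norm_one] at h1
  exact lt_irrefl _ h1

theorem one_sub_norm_le_norm_one_sub_inner {x y : E} (hx : ‖x‖ < 1) :
    1 - ‖y‖ ≤ ‖1 - inner ℂ y x‖ := by
  have h1 : ‖(1 : ℂ)‖ - ‖inner ℂ y x‖ ≤ ‖1 - inner ℂ y x‖ := norm_sub_norm_le _ _
  have h2 : ‖inner ℂ y x‖ ≤ ‖y‖ * ‖x‖ := norm_inner_le_norm _ _
  rw [norm_one] at h1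
  nlinarith [norm_nonneg y]

/-- The numerator of the Möbius involution `ballInvolution a`. -/
noncomputable def ballInvolutionNum (a z : E) : E :=
  -- With `s = √(1 - ‖a‖²)` and `P` the projection onto `ℂ a`, this is `a - P z - s (z - P z)`:
  -- since `‖a‖² = (1 - s)(1 + s)`, no division by `‖a‖²` is needed and `a = 0` is allowed.
  (1 - inner ℂ a z / (1 + (√(1 - ‖a‖ ^ 2) : ℂ))) • a - (√(1 - ‖a‖ ^ 2) : ℂ) • z

/-- The involutive automorphism of the unit ball that exchanges `0` and `a`. -/
noncomputable def ballInvolution (a z : E) : E :=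
  (1 - inner ℂ a z)⁻¹ • ballInvolutionNum a z

theorem ballInvolution_zero (a : E) : ballInvolution a 0 = a := by
  simp [ballInvolution, ballInvolutionNum]

theorem one_add_sqrt_ne_zero (r : ℝ) : (1 + (√r : ℂ)) ≠ 0 := by
  have : (0 : ℝ) < 1 + √r := by positivity
  exact_mod_cast this.ne'

theorem inner_self_eq_one_sub_sqrt_sq {a : E} (ha : ‖a‖ < 1) :
    inner ℂ a a = 1 - (√(1 - ‖a‖ ^ 2) : ℂ) ^ 2 := by
  rw [inner_self_eq_norm_sq_to_K, ← Complex.ofReal_pow,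
    Real.sq_sqrt (one_sub_norm_sq_pos ha).le]
  push_cast
  simp

theorem inner_ballInvolutionNum {a : E} (ha : ‖a‖ < 1) (z : E) :
    inner ℂ a (ballInvolutionNum a z) = 1 - (√(1 - ‖a‖ ^ 2) : ℂ) ^ 2 - inner ℂ a z := by
  have h := one_add_sqrt_ne_zero (1 - ‖a‖ ^ 2)
  rw [ballInvolutionNum, inner_sub_right, inner_smul_right, inner_smul_right,
    inner_self_eq_one_sub_sqrt_sq ha]
  field_simp
  ring

theorem ballInvolution_involutive {a z : E} (ha : ‖a‖ < 1) (hz : ‖z‖ < 1) :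
    ballInvolution a (ballInvolution a z) = z := by
  have h := one_add_sqrt_ne_zero (1 - ‖a‖ ^ 2)
  have hs := sqrt_one_sub_ne_zero ha
  have ht := one_sub_inner_ne_zero hz ha.le
  have hin : inner ℂ a (ballInvolution a z) =
      (1 - inner ℂ a z)⁻¹ * (1 - (√(1 - ‖a‖ ^ 2) : ℂ) ^ 2 - inner ℂ a z) := by
    rw [ballInvolution, inner_smul_right, inner_ballInvolutionNum ha]
  have h1 : 1 - inner ℂ a (ballInvolution a z) =
      (√(1 - ‖a‖ ^ 2) : ℂ) ^ 2 / (1 - inner ℂ a z) := by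
    rw [hin]
    field_simp
    ring
  rw [ballInvolution, h1, ballInvolutionNum, hin, ballInvolution, ballInvolutionNum]
  generalize inner ℂ a z = t at *
  generalize (√(1 - ‖a‖ ^ 2) : ℂ) = s at *
  match_scalars
  · field_simp
    ring
  · field_simp

theorem norm_ballInvolutionNum_sq {a : E} (ha : ‖a‖ < 1) (z : E) :
    ‖1 - inner ℂ a z‖ ^ 2 - ‖ballInvolutionNum a z‖ ^ 2 = (1 - ‖a‖ ^ 2) * (1 - ‖z‖ ^ 2) := by
  have hs : √(1 - ‖a‖ ^ 2) ^ 2 = 1 - ‖a‖ ^ 2 := Real.sq_sqrt (one_sub_norm_sq_pos ha).le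
  have hs0 : 0 ≤ √(1 - ‖a‖ ^ 2) := Real.sqrt_nonneg _
  rw [ballInvolutionNum, norm_sub_sq (𝕜 := ℂ) (_ • a) (_ • z), inner_smul_left, inner_smul_right, norm_smul, norm_smul,
    mul_pow, mul_pow, Complex.sq_norm, Complex.sq_norm, Complex.sq_norm]
  generalize inner ℂ a z = t at *
  have ha2 : ‖a‖ ^ 2 = 1 - √(1 - ‖a‖ ^ 2) ^ 2 := by linarith
  generalize √(1 - ‖a‖ ^ 2) = s at *
  rw [ha2]
  have h1 : (1 - t / (1 + (s : ℂ))) = 1 - ((1 + s)⁻¹ : ℝ) * t := by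
    push_cast
    ring
  have hk : (1 + s) * (1 + s)⁻¹ = 1 := mul_inv_cancel₀ (by positivity)
  rw [h1]
  generalize (1 + s)⁻¹ = k at *
  obtain ⟨p, q⟩ := t
  simp [Complex.normSq_apply]
  -- The only relation between `s` and `k = 1/(1 + s)`; it reduces the goal to a polynomial identity
  -- in `p`, `q`.
  have h2 : s * k = 1 - k := by linarith
  have h3 : s ^ 2 * k = s - 1 + k := by linear_combination (s - 1) * h2
  have h4 : s ^ 2 * k ^ 2 = (1 - k) ^ 2 := by linear_combination (s * k + 1 - k) * h2
  linear_combination (-2 * p) * h3 + (p ^ 2 + q ^ 2) * h4 - 2 * (p ^ 2 + q ^ 2) * h2 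

theorem one_sub_norm_ballInvolution_sq {a z : E} (ha : ‖a‖ < 1) (hz : ‖z‖ < 1) :
    1 - ‖ballInvolution a z‖ ^ 2 =
      (1 - ‖a‖ ^ 2) * (1 - ‖z‖ ^ 2) / ‖1 - inner ℂ a z‖ ^ 2 := by
  have ht := norm_ne_zero_iff.2 (one_sub_inner_ne_zero hz ha.le)
  rw [← norm_ballInvolutionNum_sq ha, ballInvolution, norm_smul, norm_inv]
  field_simp

theorem norm_ballInvolution_lt_one {a z : E} (ha : ‖a‖ < 1) (hz : ‖z‖ < 1) :
    ‖ballInvolution a z‖ < 1 := by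
  have h : 0 < 1 - ‖ballInvolution a z‖ ^ 2 := by
    rw [one_sub_norm_ballInvolution_sq ha hz]
    have := norm_pos_iff.2 (one_sub_inner_ne_zero hz ha.le)
    have := one_sub_norm_sq_pos ha
    have := one_sub_norm_sq_pos hz
    positivity
  nlinarith [norm_nonneg (ballInvolution a z)]

theorem mapsTo_ballInvolution {a : E} (ha : ‖a‖ < 1) :
    Set.MapsTo (ballInvolution a) (Metric.ball 0 1) (Metric.ball 0 1) := by
  intro z hz
  rw [mem_ball_zero_iff] at *
  exact norm_ballInvolution_lt_one ha hz

theorem differentiableOn_ballInvolution {a : E} (ha : ‖a‖ < 1) :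
    DifferentiableOn ℂ (ballInvolution a) (Metric.ball 0 1) := by
  have hi : Differentiable ℂ fun z : E => inner ℂ a z := (innerSL ℂ a).differentiable
  intro z hz
  have ht := one_sub_inner_ne_zero (mem_ball_zero_iff.1 hz) ha.le
  apply DifferentiableAt.differentiableWithinAt
  unfold ballInvolution ballInvolutionNum
  have := hi z
  fun_prop (disch := assumption)

theorem ballInvolution_self {a : E} (ha : ‖a‖ < 1) : ballInvolution a a = 0 := by
  conv_lhs => rw [← ballInvolution_zero a]
  rw [show ballInvolution (ballInvolution a 0) (ballInvolution a 0) =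
    ballInvolution a (ballInvolution a 0) by rw [ballInvolution_zero]]
  exact ballInvolution_involutive ha (by simp)

/-! ### Bergman ratio: Schwarz–Pick, coercivity, convexity -/

/-- The invariant `cosh² d(x, y)`, with `d` the Bergman distance of the unit ball. -/
noncomputable def bergmanRatio (x y : E) : ℝ :=
  ‖1 - inner ℂ y x‖ ^ 2 / ((1 - ‖x‖ ^ 2) * (1 - ‖y‖ ^ 2))

theorem one_sub_norm_ballInvolution_sq_eq_inv {a z : E} (ha : ‖a‖ < 1) (hz : ‖z‖ < 1) :
    1 - ‖ballInvolution a z‖ ^ 2 = (bergmanRatio z a)⁻¹ := by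
  rw [one_sub_norm_ballInvolution_sq ha hz, bergmanRatio, inv_div, mul_comm]

theorem bergmanRatio_pos {x y : E} (hx : ‖x‖ < 1) (hy : ‖y‖ < 1) : 0 < bergmanRatio x y := by
  have := norm_pos_iff.2 (one_sub_inner_ne_zero hx hy.le)
  have := one_sub_norm_sq_pos hx
  have := one_sub_norm_sq_pos hy
  unfold bergmanRatio
  positivity

/-- The **Schwarz–Pick lemma** for holomorphic self-maps of the unit ball. -/
theorem bergmanRatio_le_of_mapsTo_ball {g : E → E}
    (hd : DifferentiableOn ℂ g (Metric.ball 0 1))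
    (hg : Set.MapsTo g (Metric.ball 0 1) (Metric.ball 0 1)) {x y : E} (hx : ‖x‖ < 1)
    (hy : ‖y‖ < 1) : bergmanRatio (g x) (g y) ≤ bergmanRatio x y := by
  have hgx : ‖g x‖ < 1 := mem_ball_zero_iff.1 (hg (mem_ball_zero_iff.2 hx))
  have hgy : ‖g y‖ < 1 := mem_ball_zero_iff.1 (hg (mem_ball_zero_iff.2 hy))
  -- Conjugating `g` by the involutions at `y` and `g y` gives a self-map fixing `0`, to which the
  -- classical Schwarz lemma applies.
  have hmaps := (mapsTo_ballInvolution hgy).comp (hg.comp (mapsTo_ballInvolution hy))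
  have hdiff := (differentiableOn_ballInvolution hgy).comp
    (hd.comp (differentiableOn_ballInvolution hy) (mapsTo_ballInvolution hy))
    (hg.comp (mapsTo_ballInvolution hy))
  have key := Complex.norm_le_norm_of_mapsTo_ball hdiff
    (hmaps.mono_right Metric.ball_subset_closedBall)
    (by simp [ballInvolution_zero, ballInvolution_self hgy]) (norm_ballInvolution_lt_one hy hx)
  simp only [Function.comp_apply, ballInvolution_involutive hy hx] at key
  rw [← inv_le_inv₀ (bergmanRatio_pos hx hy) (bergmanRatio_pos hgx hgy),
    ← one_sub_norm_ballInvolution_sq_eq_inv hy hx,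
    ← one_sub_norm_ballInvolution_sq_eq_inv hgy hgx]
  gcongr

theorem bergmanRatio_le_of_norm_le {x y : E} {r : ℝ} (hr : r < 1) (hx : ‖x‖ ≤ r)
    (hy : ‖y‖ ≤ r) : bergmanRatio x y ≤ 4 / (1 - r ^ 2) ^ 2 := by
  have hr0 : 0 ≤ r := (norm_nonneg x).trans hx
  have h1 : ‖1 - inner ℂ y x‖ ≤ 2 := by
    have h := norm_sub_le (1 : ℂ) (inner ℂ y x)
    have := norm_inner_lt_one (hx.trans_lt hr) (hy.trans hr.le)
    rw [norm_one] at h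
    linarith
  have hp : 0 < 1 - r ^ 2 := by nlinarith
  rw [bergmanRatio, sq (1 - r ^ 2), show (4 : ℝ) = 2 ^ 2 by norm_num]
  have hx2 : ‖x‖ ^ 2 ≤ r ^ 2 := by gcongr
  have hy2 : ‖y‖ ^ 2 ≤ r ^ 2 := by gcongr
  gcongr
  linarith

theorem exists_norm_le_of_bergmanRatio_le {r : ℝ} (hr : r < 1) (A : ℝ) :
    ∃ r' < 1, ∀ x y : E, ‖x‖ < 1 → ‖y‖ ≤ r → bergmanRatio x y ≤ A → ‖x‖ ≤ r' := by
  have hA : 0 < max A 1 := lt_max_of_lt_right one_pos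
  -- From `(1 - r)² ≤ ‖1 - ⟪y, x⟫‖² ≤ max A 1 * (1 - ‖x‖²)`; the maximum keeps the divisor positive.
  refine ⟨√(1 - (1 - r) ^ 2 / max A 1), ?_, fun x y hx hy h => ?_⟩
  · rw [Real.sqrt_lt' one_pos]
    have : 0 < (1 - r) ^ 2 / max A 1 := by
      have : 0 < 1 - r := by linarith
      positivity
    linarith
  · apply Real.le_sqrt_of_sq_le
    have hx2 := one_sub_norm_sq_pos hx
    have hy2 := one_sub_norm_sq_pos (hy.trans_lt hr)
    have h1 := one_sub_norm_le_norm_one_sub_inner (y := y) hx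
    have h2 : (1 - r) ^ 2 ≤ ‖1 - inner ℂ y x‖ ^ 2 := by
      have : 0 ≤ 1 - r := by linarith
      gcongr
      linarith
    rw [bergmanRatio, div_le_iff₀ (by positivity)] at h
    have h3 : A * ((1 - ‖x‖ ^ 2) * (1 - ‖y‖ ^ 2)) ≤ max A 1 * ((1 - ‖x‖ ^ 2) * 1) := by
      gcongr
      · exact le_max_left _ _
      · nlinarith [norm_nonneg y]
    have h4 : (1 - r) ^ 2 / max A 1 ≤ 1 - ‖x‖ ^ 2 := by
      rw [div_le_iff₀ hA]
      linarith
    linarith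

theorem norm_midpoint_sq (x y : E) :
    ‖(2⁻¹ : ℂ) • (x + y)‖ ^ 2 = (‖x‖ ^ 2 + ‖y‖ ^ 2) / 2 - ‖x - y‖ ^ 2 / 4 := by
  have h := parallelogram_law_with_norm ℂ x y
  rw [norm_smul, mul_pow, norm_inv, Complex.norm_ofNat]
  linarith

theorem norm_midpoint_lt_one {x y : E} (hx : ‖x‖ < 1) (hy : ‖y‖ < 1) :
    ‖(2⁻¹ : ℂ) • (x + y)‖ < 1 := by
  have h := norm_midpoint_sq x y
  have := one_sub_norm_sq_pos hx
  have := one_sub_norm_sq_pos hy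
  nlinarith [norm_nonneg ((2⁻¹ : ℂ) • (x + y)), sq_nonneg ‖x - y‖]

/-- Joint convexity of `α² / t`: after clearing denominators the difference is `(α s - β t)²`. -/
theorem add_sq_div_add_le {α β s t : ℝ} (ht : 0 < t) (hs : 0 < s) :
    (α + β) ^ 2 / (t + s) ≤ α ^ 2 / t + β ^ 2 / s := by
  rw [div_add_div _ _ ht.ne' hs.ne', div_le_div_iff₀ (by positivity) (by positivity)]
  nlinarith [sq_nonneg (α * s - β * t)]

/-- Uniform midpoint convexity of `bergmanRatio` in its first argument. -/
theorem bergmanRatio_midpoint_le {x y z : E} {r : ℝ} (hr : r < 1) (hx : ‖x‖ < 1)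
    (hy : ‖y‖ < 1) (hz : ‖z‖ ≤ r) :
    bergmanRatio ((2⁻¹ : ℂ) • (x + y)) z ≤
      (bergmanRatio x z + bergmanRatio y z) / 2 - (1 - r) ^ 2 / 4 * ‖x - y‖ ^ 2 := by
  have hm := norm_midpoint_lt_one hx hy
  have ht := one_sub_norm_sq_pos hx
  have hs := one_sub_norm_sq_pos hy
  have hu := one_sub_norm_sq_pos (hz.trans_lt hr)
  have hT := one_sub_norm_sq_pos hm
  have hκ := one_sub_norm_le_norm_one_sub_inner (y := z) hm
  have hκ2 : ‖1 - inner ℂ z ((2⁻¹ : ℂ) • (x + y))‖ ≤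
      (‖1 - inner ℂ z x‖ + ‖1 - inner ℂ z y‖) / 2 := by
    have h : 1 - inner ℂ z ((2⁻¹ : ℂ) • (x + y)) =
        2⁻¹ * ((1 - inner ℂ z x) + (1 - inner ℂ z y)) := by
      rw [inner_smul_right, inner_add_right]
      ring
    rw [h, norm_mul, norm_inv, Complex.norm_ofNat]
    have := norm_add_le (1 - inner ℂ z x) (1 - inner ℂ z y)
    linarith
  have hconv := add_sq_div_add_le (α := ‖1 - inner ℂ z x‖) (β := ‖1 - inner ℂ z y‖) ht hs
  have hmid := norm_midpoint_sq x y
  unfold bergmanRatio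
  simp only [← div_div]
  rw [← add_div, div_right_comm _ _ (2 : ℝ)]
  generalize ‖1 - inner ℂ z ((2⁻¹ : ℂ) • (x + y))‖ = κ at *
  generalize ‖1 - inner ℂ z x‖ = α at *
  generalize ‖1 - inner ℂ z y‖ = β at *
  -- The surplus `‖x - y‖² / 4` in this denominator is what makes the convexity uniform.
  have hδ : 1 - ‖(2⁻¹ : ℂ) • (x + y)‖ ^ 2 =
    ((1 - ‖x‖ ^ 2) + (1 - ‖y‖ ^ 2)) / 2 + ‖x - y‖ ^ 2 / 4 := by linarith
  have hle : 1 - ‖(2⁻¹ : ℂ) • (x + y)‖ ^ 2 ≤ 1 := by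
    nlinarith [norm_nonneg ((2⁻¹ : ℂ) • (x + y))]
  have hu1 : 1 - ‖z‖ ^ 2 ≤ 1 := by nlinarith [norm_nonneg z]
  rw [hδ] at hle hT ⊢
  have hd : 0 ≤ ‖x - y‖ ^ 2 / 4 := by positivity
  rw [show (1 - r) ^ 2 / 4 * ‖x - y‖ ^ 2 = (1 - r) ^ 2 * (‖x - y‖ ^ 2 / 4) by ring]
  generalize ‖x - y‖ ^ 2 / 4 = δ at *
  generalize 1 - ‖x‖ ^ 2 = t at *
  generalize 1 - ‖y‖ ^ 2 = s at *
  have hκr : 1 - r ≤ κ := by linarith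
  have hr0 : 0 ≤ 1 - r := by linarith
  have hκsq : (1 - r) ^ 2 ≤ κ ^ 2 := by gcongr
  have hTpos : 0 < (t + s) / 2 := by positivity
  have h1 : κ ^ 2 / ((t + s) / 2) ≤ (α ^ 2 / t + β ^ 2 / s) / 2 := by
    have h2 : κ ^ 2 ≤ ((α + β) / 2) ^ 2 := by
      have : 0 ≤ κ := hr0.trans hκr
      gcongr
    calc κ ^ 2 / ((t + s) / 2) ≤ ((α + β) / 2) ^ 2 / ((t + s) / 2) := by gcongr
      _ = (α + β) ^ 2 / (t + s) / 2 := by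
        field_simp
      _ ≤ _ := by linarith
  have h3 : κ ^ 2 / ((t + s) / 2 + δ) ≤ κ ^ 2 / ((t + s) / 2) - (1 - r) ^ 2 * δ := by
    have h4 : (1 - r) ^ 2 ≤ κ ^ 2 / ((t + s) / 2) := by
      rw [le_div_iff₀ hTpos]
      nlinarith [sq_nonneg (1 - r)]
    have h5 : κ ^ 2 / ((t + s) / 2) * ((t + s) / 2) = κ ^ 2 := div_mul_cancel₀ _ hTpos.ne'
    rw [div_le_iff₀ hT]
    generalize κ ^ 2 / ((t + s) / 2) = q at *
    have hq : 0 ≤ q := (sq_nonneg _).trans h4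
    have h6 : (1 - r) ^ 2 * δ * ((t + s) / 2 + δ) ≤ q * δ * 1 := by gcongr
    nlinarith
  have h7 : (1 - r) ^ 2 * δ ≤ (1 - r) ^ 2 * δ / (1 - ‖z‖ ^ 2) := by
    rw [le_div_iff₀ hu]
    have : 0 ≤ (1 - r) ^ 2 * δ := by positivity
    nlinarith
  calc κ ^ 2 / ((t + s) / 2 + δ) / (1 - ‖z‖ ^ 2)
      ≤ ((α ^ 2 / t + β ^ 2 / s) / 2 - (1 - r) ^ 2 * δ) / (1 - ‖z‖ ^ 2) := by
        gcongr
        linarith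
    _ = (α ^ 2 / t + β ^ 2 / s) / 2 / (1 - ‖z‖ ^ 2) - (1 - r) ^ 2 * δ / (1 - ‖z‖ ^ 2) := by
        rw [sub_div]
    _ ≤ _ := by linarith

theorem continuousOn_bergmanRatio {y : E} (hy : ‖y‖ < 1) :
    ContinuousOn (fun x => bergmanRatio x y) (Metric.ball 0 1) := by
  unfold bergmanRatio
  refine ContinuousOn.div (by fun_prop) (by fun_prop) fun x hx => ?_
  exact (mul_pos (one_sub_norm_sq_pos (mem_ball_zero_iff.1 hx)) (one_sub_norm_sq_pos hy)).ne'

/-! ### Fixed points from relatively compact orbits -/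

/-- A holomorphic self-map of the unit ball with a relatively compact orbit has a fixed point. -/
theorem exists_fixedPoint_of_norm_orbit_le [ProperSpace E] {g : E → E}
    (hd : DifferentiableOn ℂ g (Metric.ball 0 1))
    (hg : Set.MapsTo g (Metric.ball 0 1) (Metric.ball 0 1)) {z : ℕ → E}
    (hz : ∀ i, z (i + 1) = g (z i)) {r : ℝ} (hr : r < 1) (hb : ∀ i, ‖z i‖ ≤ r) :
    ∃ w, ‖w‖ < 1 ∧ g w = w := by
  have hz1 : ∀ i, ‖z i‖ < 1 := fun i => (hb i).trans_lt hr
  have hr0 : 0 ≤ r := (norm_nonneg _).trans (hb 0)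
  have hg1 : ∀ x, ‖x‖ < 1 → ‖g x‖ < 1 := fun x hx =>
    mem_ball_zero_iff.1 (hg (mem_ball_zero_iff.2 hx))
  have h0 : ∀ i, bergmanRatio 0 (z i) ≤ 4 / (1 - r ^ 2) ^ 2 := fun i =>
    bergmanRatio_le_of_norm_le hr (by simpa using hr0) (hb i)
  -- Outside radius `ρ` every ratio to an orbit point exceeds its value at `0`, so a minimizer over
  -- the closed `ρ`-ball is a minimizer over the whole unit ball.
  obtain ⟨ρ, hρ, hcoer⟩ := exists_norm_le_of_bergmanRatio_le (E := E) hr (4 / (1 - r ^ 2) ^ 2)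
  have hρ0 : 0 ≤ ρ := by simpa using hcoer 0 (z 0) (by simp) (hb 0) (h0 0)
  obtain ⟨ρ', hρ', hcoer'⟩ := exists_norm_le_of_bergmanRatio_le (E := E) hr
    (4 / (1 - (max ρ r) ^ 2) ^ 2)
  have hgρ : ∀ x, ‖x‖ ≤ ρ → ‖g x‖ ≤ ρ' := fun x hx => by
    have hx1 := hx.trans_lt hρ
    refine hcoer' (g x) (z 1) (hg1 x hx1) (hb 1) ?_
    rw [hz 0]
    exact (bergmanRatio_le_of_mapsTo_ball hd hg hx1 (hz1 0)).trans
      (bergmanRatio_le_of_norm_le (max_lt hρ hr) (hx.trans (le_max_left _ _))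
        ((hb 0).trans (le_max_right _ _)))
  -- Bounds the one extra term created by shifting the orbit, independently of `N`.
  set C : ℝ := 4 / (1 - (max ρ' r) ^ 2) ^ 2
  have hC : ∀ x, ‖x‖ ≤ ρ → bergmanRatio (g x) (z 0) ≤ C := fun x hx =>
    bergmanRatio_le_of_norm_le (max_lt hρ' hr) ((hgρ x hx).trans (le_max_left _ _))
      ((hb 0).trans (le_max_right _ _))
  have hsub : Metric.closedBall (0 : E) ρ ⊆ Metric.ball 0 1 := Metric.closedBall_subset_ball hρ
  have hne : (Metric.closedBall (0 : E) ρ).Nonempty := ⟨0, by simpa using hρ0⟩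
  have happrox : ∀ N : ℕ, ∃ x : E, ‖x‖ ≤ ρ ∧
      N * ((1 - r) ^ 2 / 4 * ‖x - g x‖ ^ 2) ≤ C / 2 := by
    intro N
    obtain ⟨x, hxρ, hmin⟩ := (isCompact_closedBall (0 : E) ρ).exists_isMinOn hne
      (f := fun x => ∑ i ∈ Finset.range N, bergmanRatio x (z i))
      (continuousOn_finsetSum _ fun i _ => (continuousOn_bergmanRatio (hz1 i)).mono hsub)
    rw [mem_closedBall_zero_iff] at hxρ
    have hx1 := hxρ.trans_lt hρ
    have hmin' : ∀ y : E, ‖y‖ < 1 → ∑ i ∈ Finset.range N, bergmanRatio x (z i) ≤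
        ∑ i ∈ Finset.range N, bergmanRatio y (z i) := by
      intro y hy
      by_cases hyρ : ‖y‖ ≤ ρ
      · exact hmin (mem_closedBall_zero_iff.2 hyρ)
      · refine (hmin (Metric.mem_closedBall_self hρ0)).trans (Finset.sum_le_sum fun i _ => ?_)
        refine (h0 i).trans (le_of_not_ge fun h => hyρ (hcoer y (z i) hy (hb i) h))
    have hshift : ∑ i ∈ Finset.range N, bergmanRatio (g x) (z i) ≤
        ∑ i ∈ Finset.range N, bergmanRatio x (z i) + C := by
      calc ∑ i ∈ Finset.range N, bergmanRatio (g x) (z i)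
          ≤ ∑ i ∈ Finset.range (N + 1), bergmanRatio (g x) (z i) := by
            rw [Finset.sum_range_succ]
            linarith [bergmanRatio_pos (hg1 x hx1) (hz1 N)]
        _ = ∑ i ∈ Finset.range N, bergmanRatio (g x) (g (z i)) + bergmanRatio (g x) (z 0) := by
            rw [Finset.sum_range_succ']
            simp only [hz]
        _ ≤ _ := by
            gcongr with i _
            · exact bergmanRatio_le_of_mapsTo_ball hd hg hx1 (hz1 i)
            · exact hC x hxρ
    -- With `F` the sum, `F x ≤ F (midpoint) ≤ (F x + F (g x)) / 2 - N c ‖x - g x‖²`, and `F (g x) ≤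
    -- F x + C`; so `x` is almost fixed for large `N`.
    have hmid := (hmin' _ (norm_midpoint_lt_one hx1 (hg1 x hx1))).trans
      (Finset.sum_le_sum fun i _ => bergmanRatio_midpoint_le hr hx1 (hg1 x hx1) (hb i))
    rw [Finset.sum_sub_distrib, ← Finset.sum_div, Finset.sum_add_distrib, Finset.sum_const,
      Finset.card_range, nsmul_eq_mul] at hmid
    exact ⟨x, hxρ, by linarith⟩
  obtain ⟨w, hwρ, hmin⟩ := (isCompact_closedBall (0 : E) ρ).exists_isMinOn hne
    (f := fun x => ‖x - g x‖) (continuousOn_id.sub (hd.continuousOn.mono hsub)).norm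
  refine ⟨w, (mem_closedBall_zero_iff.1 hwρ).trans_lt hρ, ?_⟩
  by_contra hne
  have hpos : 0 < (1 - r) ^ 2 / 4 * ‖w - g w‖ ^ 2 := by
    have h1 : 0 < ‖w - g w‖ := norm_pos_iff.2 (sub_ne_zero.2 (Ne.symm hne))
    have h2 : 0 < 1 - r := by linarith
    positivity
  obtain ⟨N, hN⟩ := exists_lt_nsmul hpos (C / 2)
  obtain ⟨x, hx, hxN⟩ := happrox N
  have hle : ‖w - g w‖ ≤ ‖x - g x‖ := hmin (mem_closedBall_zero_iff.2 hx)
  have : N * ((1 - r) ^ 2 / 4 * ‖w - g w‖ ^ 2) ≤ N * ((1 - r) ^ 2 / 4 * ‖x - g x‖ ^ 2) := by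
    gcongr
  rw [nsmul_eq_mul] at hN
  linarith

/-! ### Orbits either tend to the boundary or stay relatively compact -/

theorem bergmanRatio_orbit_le {g : E → E} (hd : DifferentiableOn ℂ g (Metric.ball 0 1))
    (hg : Set.MapsTo g (Metric.ball 0 1) (Metric.ball 0 1)) {z : ℕ → E}
    (hz : ∀ i, z (i + 1) = g (z i)) (hz1 : ∀ i, ‖z i‖ < 1) (i j k : ℕ) :
    bergmanRatio (z (i + k)) (z (j + k)) ≤ bergmanRatio (z i) (z j) := by
  induction k with
  | zero => rfl
  | succ k ih =>
    rw [← add_assoc, ← add_assoc, hz, hz]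
    exact (bergmanRatio_le_of_mapsTo_ball hd hg (hz1 _) (hz1 _)).trans ih

/-- `‖1 - ⟪y, x⟫‖²` equals `(1 - ‖x‖²)(1 - ‖y‖²) + ‖x - y‖²` minus the Cauchy–Schwarz defect
`‖x‖²‖y‖² - ‖⟪y, x⟫‖²`. -/
theorem bergmanRatio_le_one_add {x y : E} (hx : ‖x‖ < 1) (hy : ‖y‖ < 1) :
    bergmanRatio x y ≤ 1 + ‖x - y‖ ^ 2 / ((1 - ‖x‖ ^ 2) * (1 - ‖y‖ ^ 2)) := by
  have hp := mul_pos (one_sub_norm_sq_pos hx) (one_sub_norm_sq_pos hy)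
  rw [bergmanRatio, one_add_div hp.ne']
  gcongr
  have h1 := norm_sub_sq (𝕜 := ℂ) x y
  have h2 : ‖inner ℂ y x‖ ^ 2 ≤ (‖y‖ * ‖x‖) ^ 2 := by
    gcongr
    exact norm_inner_le_norm _ _
  have h3 : ‖1 - inner ℂ y x‖ ^ 2 = 1 - 2 * RCLike.re (inner ℂ x y) + ‖inner ℂ y x‖ ^ 2 := by
    rw [← inner_conj_symm x y, Complex.sq_norm, Complex.sq_norm]
    generalize inner ℂ y x = t
    simp [Complex.normSq_apply]
    ring
  rw [h3, h1]
  nlinarith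

/-- **Całka's theorem** for the unit ball: an orbit that does not tend to the boundary is
relatively compact. -/
theorem exists_norm_orbit_le [ProperSpace E] {g : E → E}
    (hd : DifferentiableOn ℂ g (Metric.ball 0 1))
    (hg : Set.MapsTo g (Metric.ball 0 1) (Metric.ball 0 1)) {z : ℕ → E}
    (hz : ∀ i, z (i + 1) = g (z i)) (hz1 : ∀ i, ‖z i‖ < 1)
    (hnt : ¬ Tendsto (fun i => ‖z i‖) atTop (𝓝 1)) : ∃ r < 1, ∀ i, ‖z i‖ ≤ r := by
  obtain ⟨r₀, hr₀, hfreq, hz0⟩ :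
      ∃ r₀ < 1, (∀ i, ∃ j > i, ‖z j‖ ≤ r₀) ∧ ‖z 0‖ ≤ r₀ := by
    rw [tendsto_order] at hnt
    push Not at hnt
    by_cases h : ∃ a < 1, ¬ ∀ᶠ i in atTop, a < ‖z i‖
    · obtain ⟨a, ha, h⟩ := h
      refine ⟨max a ‖z 0‖, max_lt ha (hz1 0), fun i => ?_, le_max_right _ _⟩
      by_contra! hcon
      exact h ((eventually_gt_atTop i).mono fun j hj => (le_max_left _ _).trans_lt (hcon j hj))
    · push Not at h
      obtain ⟨a, ha, hfr⟩ := hnt h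
      exact (hfr.exists.elim fun i hi => absurd ((hz1 i).trans ha) hi.not_gt)
  obtain ⟨r₁, hr₁, hnear⟩ := exists_norm_le_of_bergmanRatio_le (E := E) hr₀ 2
  have hr₁' : ∀ i, ‖z i‖ ≤ r₀ → ‖z i‖ ≤ r₁ := fun i hi => by
    refine hnear (z i) (z i) (hz1 i) hi ((bergmanRatio_le_one_add (hz1 i) (hz1 i)).trans ?_)
    simp
  have hr₁0 : 0 ≤ r₁ := (norm_nonneg _).trans (hr₁' 0 hz0)
  have hδ : 0 < 1 - r₁ ^ 2 := by nlinarith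
  -- At mesh `1 - r₁²` within radius `r₁`, neighbours have ratio at most `1 + 1 = 2`, the constant
  -- defining `r₁`.
  obtain ⟨T, hTsub, hTfin, hT⟩ := Metric.finite_approx_of_totallyBounded
    ((isCompact_closedBall (0 : E) r₁).totallyBounded.subset
      (show {x | ‖x‖ ≤ r₁ ∧ x ∈ Set.range z} ⊆ _ from
        fun x hx => mem_closedBall_zero_iff.2 hx.1)) (1 - r₁ ^ 2) hδ
  have hret : ∀ x : E, ∃ m : ℕ, x ∈ T → 0 < m ∧ ∃ i, x = z i ∧ ‖z (i + m)‖ ≤ r₀ := by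
    intro x
    by_cases hx : x ∈ T
    · obtain ⟨-, i, rfl⟩ := hTsub hx
      obtain ⟨j, hj, hjr⟩ := hfreq i
      exact ⟨j - i, fun _ => ⟨by omega, i, rfl, by rwa [Nat.add_sub_of_le hj.le]⟩⟩
    · exact ⟨0, fun h => absurd h hx⟩
  choose m hm using hret
  obtain ⟨M, hM⟩ : ∃ M, ∀ x ∈ T, m x ≤ M := by
    obtain ⟨M, hM⟩ := (hTfin.image m).bddAbove
    exact ⟨M, fun x hx => hM (Set.mem_image_of_mem m hx)⟩
  -- `z i` shadows a net point `z j` until the latter returns to radius `r₀`; the ratio is still at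
  -- most `2`, so `z i` is then back within `r₁`. Finiteness of the net bounds the return times.
  have hreturn : ∀ i, ‖z i‖ ≤ r₁ → ∃ l, 0 < l ∧ l ≤ M ∧ ‖z (i + l)‖ ≤ r₁ := by
    intro i hi
    obtain ⟨x, hxT, hx⟩ := Set.mem_iUnion₂.1 (hT ⟨hi, i, rfl⟩)
    obtain ⟨hpos, j, rfl, hj⟩ := hm x hxT
    refine ⟨m (z j), hpos, hM _ hxT, hnear _ (z (j + m (z j))) (hz1 _) hj ?_⟩
    refine (bergmanRatio_orbit_le hd hg hz hz1 _ _ _).trans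
      ((bergmanRatio_le_one_add (hz1 i) (hz1 j)).trans ?_)
    have hjr : ‖z j‖ ≤ r₁ := (hTsub hxT).1
    have hle : ‖z i - z j‖ ^ 2 / ((1 - ‖z i‖ ^ 2) * (1 - ‖z j‖ ^ 2)) ≤
        (1 - r₁ ^ 2) ^ 2 / ((1 - r₁ ^ 2) * (1 - r₁ ^ 2)) := by
      rw [Metric.mem_ball, dist_eq_norm] at hx
      have := one_sub_norm_sq_pos (hz1 i)
      gcongr
    rw [← sq, div_self (by positivity)] at hle
    linarith
  have hcover : ∀ k, ∃ s ≤ M, ∃ i, ‖z i‖ ≤ r₁ ∧ k = i + s := by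
    intro k
    induction k with
    | zero => exact ⟨0, Nat.zero_le _, 0, hr₁' 0 hz0, rfl⟩
    | succ k ih =>
      obtain ⟨s, hs, i, hi, rfl⟩ := ih
      obtain hlt | rfl := hs.lt_or_eq
      · exact ⟨s + 1, hlt, i, hi, rfl⟩
      · obtain ⟨l, hl, hls, hil⟩ := hreturn i hi
        exact ⟨s + 1 - l, by omega, i + l, hil, by omega⟩
  obtain ⟨r₂, hr₂, hinit⟩ : ∃ r₂ < 1, ∀ s ≤ M, ‖z s‖ ≤ r₂ := by
    obtain ⟨s, -, hs⟩ := Finset.exists_max_image (Finset.range (M + 1)) (fun s => ‖z s‖)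
      ⟨0, by simp⟩
    exact ⟨‖z s‖, hz1 s, fun t ht => hs t (Finset.mem_range.2 (by omega))⟩
  obtain ⟨r₃, hr₃, hfinal⟩ := exists_norm_le_of_bergmanRatio_le (E := E) hr₂
    (4 / (1 - r₁ ^ 2) ^ 2)
  refine ⟨r₃, hr₃, fun k => ?_⟩
  obtain ⟨s, hs, i, hi, rfl⟩ := hcover k
  -- `z (i + s)` is as close to `z s` as `z i` is to `z 0`, and only finitely many `z s` with `s ≤
  -- M` occur.
  refine hfinal _ (z s) (hz1 _) (hinit s hs) ?_
  have h := bergmanRatio_orbit_le hd hg hz hz1 i 0 s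
  rw [zero_add] at h
  exact h.trans (bergmanRatio_le_of_norm_le hr₁ hi (hr₁' 0 hz0))

/-! ### Wolff's lemma and convergence to the boundary -/

/-- **Wolff's lemma**: a holomorphic self-map of the unit ball without fixed points maps every
horosphere at some boundary point `τ` into itself. -/
theorem exists_invariant_horospheres [ProperSpace E] {g : E → E}
    (hd : DifferentiableOn ℂ g (Metric.ball 0 1))
    (hg : Set.MapsTo g (Metric.ball 0 1) (Metric.ball 0 1))
    (hfix : ∀ w, ‖w‖ < 1 → g w ≠ w) :
    ∃ τ : E, ‖τ‖ = 1 ∧ ∀ x, ‖x‖ < 1 →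
      ‖1 - inner ℂ τ (g x)‖ ^ 2 / (1 - ‖g x‖ ^ 2) ≤ ‖1 - inner ℂ τ x‖ ^ 2 / (1 - ‖x‖ ^ 2) := by
  have hg1 : ∀ x, ‖x‖ < 1 → ‖g x‖ < 1 := fun x hx =>
    mem_ball_zero_iff.1 (hg (mem_ball_zero_iff.2 hx))
  obtain ⟨r, -, hr, hrlim⟩ := exists_seq_strictMono_tendsto' (zero_lt_one (α := ℝ))
  have hnorm : ∀ k x, ‖x‖ < 1 → ‖(r k : ℂ) • g x‖ ≤ r k := fun k x hx => by
    rw [norm_smul, Complex.norm_real, Real.norm_of_nonneg (hr k).1.le]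
    exact mul_le_of_le_one_right (hr k).1.le (hg1 x hx).le
  have hdk : ∀ k, DifferentiableOn ℂ (fun x => (r k : ℂ) • g x) (Metric.ball 0 1) := fun k =>
    hd.const_smul _
  have hmk : ∀ k, Set.MapsTo (fun x => (r k : ℂ) • g x) (Metric.ball 0 1) (Metric.ball 0 1) :=
    fun k x hx => mem_ball_zero_iff.2
      ((hnorm k x (mem_ball_zero_iff.1 hx)).trans_lt (hr k).2)
  -- Each `r k • g` maps the ball into radius `r k < 1`, so the orbit of `0` is relatively compact.
  have hw : ∀ k, ∃ w, ‖w‖ < 1 ∧ (r k : ℂ) • g w = w := by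
    intro k
    have hz1 : ∀ i, ‖(fun x => (r k : ℂ) • g x)^[i] 0‖ ≤ r k := by
      intro i
      induction i with
      | zero => simpa using (hr k).1.le
      | succ i ih =>
        rw [Function.iterate_succ_apply']
        exact hnorm k _ (ih.trans_lt (hr k).2)
    exact exists_fixedPoint_of_norm_orbit_le (hdk k) (hmk k)
      (fun i => Function.iterate_succ_apply' _ i 0) (hr k).2 hz1
  choose w hw1 hwfix using hw
  obtain ⟨τ, hτ, s, hs, hlim⟩ := (isCompact_closedBall (0 : E) 1).tendsto_subseq
    (fun k => mem_closedBall_zero_iff.2 (hw1 k).le)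
  rw [mem_closedBall_zero_iff] at hτ
  have hrs : Tendsto (fun k => (r (s k) : ℂ)) atTop (𝓝 1) :=
    (Complex.continuous_ofReal.tendsto 1).comp (hrlim.comp hs.tendsto_atTop)
  refine ⟨τ, hτ.eq_of_not_lt fun hlt => hfix τ hlt ?_, fun x hx => ?_⟩
  · have hcont : Tendsto (fun k => g (w (s k))) atTop (𝓝 (g τ)) :=
      ((hd.continuousOn.continuousAt
        (Metric.isOpen_ball.mem_nhds (mem_ball_zero_iff.2 hlt))).tendsto).comp hlim
    have h := hrs.smul hcont
    rw [one_smul] at h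
    exact tendsto_nhds_unique h (hlim.congr fun k => (hwfix (s k)).symm)
  · have hgx := hg1 x hx
    have hgs : Tendsto (fun k => (r (s k) : ℂ) • g x) atTop (𝓝 (g x)) := by
      simpa using hrs.smul_const (g x)
    refine le_of_tendsto_of_tendsto' (b := atTop)
      (f := fun k => ‖1 - inner ℂ (w (s k)) ((r (s k) : ℂ) • g x)‖ ^ 2 /
        (1 - ‖(r (s k) : ℂ) • g x‖ ^ 2))
      (g := fun k => ‖1 - inner ℂ (w (s k)) x‖ ^ 2 / (1 - ‖x‖ ^ 2)) ?_ ?_ fun k => ?_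
    · exact ((tendsto_const_nhds.sub (hlim.inner hgs)).norm.pow 2).div
        (tendsto_const_nhds.sub (hgs.norm.pow 2)) (one_sub_norm_sq_pos hgx).ne'
    · exact ((tendsto_const_nhds.sub (hlim.inner tendsto_const_nhds)).norm.pow 2).div_const _
    -- Since `w (s k)` is fixed, the factor `1 - ‖w (s k)‖²`, which tends to `0`, occurs on both
    -- sides and cancels before the limit.
    · have h := bergmanRatio_le_of_mapsTo_ball (hdk (s k)) (hmk (s k)) hx (hw1 (s k))
      simp only [hwfix, bergmanRatio, ← div_div] at h
      exact (div_le_div_iff_of_pos_right (one_sub_norm_sq_pos (hw1 (s k)))).1 h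

/-- A consequence of the **Denjoy–Wolff theorem** for the unit ball: orbits of a holomorphic
self-map without fixed points converge to a boundary point `τ`, in the direction of `τ`. -/
theorem exists_tendsto_inner_orbit [ProperSpace E] {g : E → E}
    (hd : DifferentiableOn ℂ g (Metric.ball 0 1))
    (hg : Set.MapsTo g (Metric.ball 0 1) (Metric.ball 0 1))
    (hfix : ∀ w, ‖w‖ < 1 → g w ≠ w) {z : ℕ → E} (hz : ∀ i, z (i + 1) = g (z i))
    (hz1 : ∀ i, ‖z i‖ < 1) :
    ∃ τ : E, ‖τ‖ = 1 ∧ Tendsto (fun i => inner ℂ τ (z i)) atTop (𝓝 1) := by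
  have hbd : Tendsto (fun i => ‖z i‖) atTop (𝓝 1) := by
    by_contra h
    obtain ⟨r, hr, hb⟩ := exists_norm_orbit_le hd hg hz hz1 h
    obtain ⟨w, hw, hgw⟩ := exists_fixedPoint_of_norm_orbit_le hd hg hz hr hb
    exact hfix w hw hgw
  obtain ⟨τ, hτ, hhoro⟩ := exists_invariant_horospheres hd hg hfix
  refine ⟨τ, hτ, ?_⟩
  set C := ‖1 - inner ℂ τ (z 0)‖ ^ 2 / (1 - ‖z 0‖ ^ 2)
  have hC : ∀ i, ‖1 - inner ℂ τ (z i)‖ ^ 2 / (1 - ‖z i‖ ^ 2) ≤ C := by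
    intro i
    induction i with
    | zero => exact le_rfl
    | succ i ih =>
      rw [hz]
      exact (hhoro _ (hz1 i)).trans ih
  have hsq : Tendsto (fun i => ‖1 - inner ℂ τ (z i)‖ ^ 2) atTop (𝓝 0) := by
    refine squeeze_zero (g := fun i => C * (1 - ‖z i‖ ^ 2)) (fun i => by positivity)
      (fun i => (div_le_iff₀ (one_sub_norm_sq_pos (hz1 i))).1 (hC i)) ?_
    simpa using (tendsto_const_nhds (x := C)).mul
      ((tendsto_const_nhds (x := (1 : ℝ))).sub (hbd.pow 2))
  have hn : Tendsto (fun i => ‖1 - inner ℂ τ (z i)‖) atTop (𝓝 0) := by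
    simpa using hsq.sqrt
  simpa using (tendsto_const_nhds (x := (1 : ℂ))).sub (tendsto_zero_iff_norm_tendsto_zero.2 hn)

end BallGeometry

/-! ### Cesàro means of the composition operator and peak functions -/

theorem compOp_pow_apply {n : ℕ} (φ : UnitBall n → UnitBall n) (hφ : HolomorphicSelfMap φ)
    (i : ℕ) (f : Hinf n) (z : UnitBall n) :
    ((compOp φ hφ ^ i) f : UnitBall n →ᵇ ℂ) z = (f : UnitBall n →ᵇ ℂ) (φ^[i] z) := by
  induction i generalizing z with
  | zero => rfl
  | succ i ih =>
    rw [pow_succ', mul_apply_eq_comp, compOp_apply, ih, Function.iterate_succ_apply]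

theorem cesaroMean_compOp_apply {n : ℕ} (φ : UnitBall n → UnitBall n)
    (hφ : HolomorphicSelfMap φ) (j : ℕ) (f : Hinf n) (z : UnitBall n) :
    (cesaroMean (compOp φ hφ) j f : UnitBall n →ᵇ ℂ) z =
      (j : ℂ)⁻¹ * ∑ i ∈ Finset.range j, (f : UnitBall n →ᵇ ℂ) (φ^[i + 1] z) := by
  have h : ∀ s : Finset ℕ, ((∑ i ∈ s, compOp φ hφ ^ i) f : UnitBall n →ᵇ ℂ) z =
      ∑ i ∈ s, (f : UnitBall n →ᵇ ℂ) (φ^[i] z) := by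
    intro s
    induction s using Finset.induction_on with
    | empty => simp
    | insert a s ha ih =>
      rw [Finset.sum_insert ha, Finset.sum_insert ha, ← ih, ← compOp_pow_apply φ hφ]
      rfl
  have h2 : ∑ i ∈ Finset.Icc 1 j, (f : UnitBall n →ᵇ ℂ) (φ^[i] z) =
      ∑ i ∈ Finset.range j, (f : UnitBall n →ᵇ ℂ) (φ^[i + 1] z) := by
    rw [Finset.range_eq_Ico, Finset.sum_Ico_add' (fun i => (f : UnitBall n →ᵇ ℂ) (φ^[i] z)) 0 j 1]
    rfl
  rw [← h2, ← h]
  rfl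

theorem norm_apply_sub_apply_le {n : ℕ} (S T : Hinf n →L[ℂ] Hinf n) (f : Hinf n)
    (hf : ‖f‖ ≤ 1) (z : UnitBall n) :
    ‖(S f : UnitBall n →ᵇ ℂ) z - (T f : UnitBall n →ᵇ ℂ) z‖ ≤ ‖S - T‖ :=
  calc ‖(S f : UnitBall n →ᵇ ℂ) z - (T f : UnitBall n →ᵇ ℂ) z‖
      = ‖((S - T) f : UnitBall n →ᵇ ℂ) z‖ := rfl
    _ ≤ ‖((S - T) f : UnitBall n →ᵇ ℂ)‖ := BoundedContinuousFunction.norm_coe_le_norm _ _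
    _ = ‖(S - T) f‖ := rfl
    _ ≤ ‖S - T‖ := (S - T).unit_le_opNorm f hf

/-- Powers of the peak function at the boundary point `τ`. -/
theorem exists_peak_pow {n : ℕ} {τ : EuclideanSpace ℂ (Fin n)} (hτ : ‖τ‖ = 1) (m : ℕ) :
    ∃ f : Hinf n, ‖f‖ ≤ 1 ∧
      ∀ z : UnitBall n, (f : UnitBall n →ᵇ ℂ) z = ((1 + inner ℂ τ (z : _)) / 2) ^ m := by
  have hi : Differentiable ℂ fun z : EuclideanSpace ℂ (Fin n) => inner ℂ τ z :=
    (innerSL ℂ τ).differentiable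
  have hhol : HolomorphicOnBall fun z : UnitBall n =>
      ((1 + inner ℂ τ (z : EuclideanSpace ℂ (Fin n))) / 2) ^ m :=
    ⟨fun z => ((1 + inner ℂ τ z) / 2) ^ m, by fun_prop, fun _ => rfl⟩
  have hb : ∀ z : UnitBall n,
      ‖((1 + inner ℂ τ (z : EuclideanSpace ℂ (Fin n))) / 2) ^ m‖ ≤ 1 := by
    intro z
    rw [norm_pow]
    refine pow_le_one₀ (norm_nonneg _) ?_
    rw [norm_div, Complex.norm_ofNat, div_le_one two_pos]
    have h1 := norm_inner_lt_one (mem_ball_zero_iff.1 z.2) hτ.le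
    have h2 := norm_add_le (1 : ℂ) (inner ℂ τ (z : EuclideanSpace ℂ (Fin n)))
    rw [norm_one] at h2
    linarith
  refine ⟨⟨BoundedContinuousFunction.ofNormedAddCommGroup _ hhol.continuous 1 hb, hhol⟩, ?_,
    fun _ => rfl⟩
  exact BoundedContinuousFunction.norm_ofNormedAddCommGroup_le _ zero_le_one hb

theorem norm_one_add_div_two_lt_one {t : ℂ} (ht : ‖t‖ < 1) : ‖(1 + t) / 2‖ < 1 := by
  rw [norm_div, Complex.norm_ofNat, div_lt_one two_pos]
  have h := norm_add_le 1 t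
  rw [norm_one] at h
  linarith

theorem theorem3p12 (n : ℕ) (φ : UnitBall n → UnitBall n) (hφ : HolomorphicSelfMap φ)
    (hfix : ∀ z : UnitBall n, φ z ≠ z) :
    ¬ UniformlyMeanErgodic (compOp φ hφ) := by
  rintro ⟨L, hL⟩
  obtain ⟨g, hd, hgφ⟩ : ∃ g : EuclideanSpace ℂ (Fin n) → EuclideanSpace ℂ (Fin n),
      DifferentiableOn ℂ g (Metric.ball 0 1) ∧ ∀ z : UnitBall n, g z = φ z := id hφ
  let z₀ : UnitBall n := ⟨0, Metric.mem_ball_self one_pos⟩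
  let z : ℕ → EuclideanSpace ℂ (Fin n) := fun i => φ^[i] z₀
  have hz1 : ∀ i, ‖z i‖ < 1 := fun i => mem_ball_zero_iff.1 (φ^[i] z₀).2
  have hmaps : Set.MapsTo g (Metric.ball 0 1) (Metric.ball 0 1) := fun x hx => by
    rw [hgφ ⟨x, hx⟩]
    exact (φ ⟨x, hx⟩).2
  have hgfix : ∀ w, ‖w‖ < 1 → g w ≠ w := fun w hw h => by
    refine hfix ⟨w, mem_ball_zero_iff.2 hw⟩ (Subtype.ext ?_)
    rw [← hgφ]
    exact h
  have hz : ∀ i, z (i + 1) = g (z i) := fun i => by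
    simp only [z, Function.iterate_succ_apply', hgφ]
  obtain ⟨τ, hτ, hlim⟩ := exists_tendsto_inner_orbit hd hmaps hgfix hz hz1
  have hpeak : ∀ i, ‖(1 + inner ℂ τ (z i)) / 2‖ < 1 := fun i =>
    norm_one_add_div_two_lt_one (norm_inner_lt_one (hz1 i) hτ.le)
  -- Two means within `1/4` of `L` differ by at most `1/2 < 1`. The value `N = 0` is harmless, the
  -- mean then being `0`.
  obtain ⟨N, hN⟩ := eventually_atTop.1 (hL.eventually_lt_const (u := 1 / 4) (by norm_num))
  have hbound : ∀ m : ℕ,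
      ‖(N : ℂ)⁻¹ * ∑ i ∈ Finset.range N, ((1 + inner ℂ τ (z (i + 1))) / 2) ^ m - 1‖ ≤ 1 / 2 := by
    intro m
    obtain ⟨f, hf, hfz⟩ := exists_peak_pow hτ m
    have hmean : ∀ k, (cesaroMean (compOp φ hφ) k f : UnitBall n →ᵇ ℂ) z₀ =
        (k : ℂ)⁻¹ * ∑ i ∈ Finset.range k, ((1 + inner ℂ τ (z (i + 1))) / 2) ^ m := fun k => by
      simp only [cesaroMean_compOp_apply, hfz, z]
    have hlim1 : Tendsto (fun i => ((1 + inner ℂ τ (z (i + 1))) / 2) ^ m) atTop (𝓝 1) := by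
      have h := ((tendsto_const_nhds (x := (1 : ℂ))).add
        ((tendsto_add_atTop_iff_nat 1).2 hlim)).div_const 2 |>.pow m
      rwa [one_add_one_eq_two, div_self two_ne_zero, one_pow] at h
    have hces : Tendsto
        (fun k => (cesaroMean (compOp φ hφ) k f : UnitBall n →ᵇ ℂ) z₀) atTop (𝓝 1) := by
      refine hlim1.cesaro_smul.congr fun k => ?_
      rw [hmean, Complex.real_smul]
      push_cast
      rfl
    rw [← hmean]
    refine le_of_tendsto (tendsto_const_nhds.sub hces).norm
      (eventually_atTop.2 ⟨N, fun k hk => ?_⟩)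
    refine (norm_apply_sub_apply_le _ _ f hf z₀).trans ?_
    have h1 := hN N le_rfl
    have h2 := hN k hk
    have h3 := norm_sub_le_norm_sub_add_norm_sub (cesaroMean (compOp φ hφ) N) L
      (cesaroMean (compOp φ hφ) k)
    rw [norm_sub_rev L] at h3
    linarith
  -- Now `N` is fixed and `m → ∞`: each of the finitely many bases has modulus below `1`.
  have hzero : Tendsto (fun m : ℕ => (N : ℂ)⁻¹ *
      ∑ i ∈ Finset.range N, ((1 + inner ℂ τ (z (i + 1))) / 2) ^ m) atTop (𝓝 0) := by
    simpa using (tendsto_finsetSum (Finset.range N) fun i _ =>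
      tendsto_pow_atTop_nhds_zero_of_norm_lt_one (hpeak (i + 1))).const_mul (N : ℂ)⁻¹
  have hfinal := le_of_tendsto' (hzero.sub_const 1).norm hbound
  norm_num at hfinal
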